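/- There is an absolute constant $c>0$ such that for every integer $n\ge 2$ and all independent, integrable, mean zero real random variables $X_{i,j}$, $i,j=1,\dots,n$, on a probability space, $$ \mathbb E\left\|(X_{i,j})_{i,j=1}^n\right\|_{2\to2}\le c\,(\ln n)^{3/2}\left(\mathbb E\max_{1\le i\le n}\left\|(X_{i,j})_{j=1}^n\right\|_2+\mathbb E\max_{1\le j\le n}\left\|(X_{i,j})_{i=1}^n\right\|_2\right), $$ where $\|\cdot\|_2$ is the Euclidean norm on $\mathbb R^n$ and $\|\cdot\|_{2\to2}$ is the operator norm of a matrix acting from $\ell_2^n$ to $\ell_2^n$. -/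

import Mathlib

open MeasureTheory ProbabilityTheory

noncomputable section

/-- The operator norm of a real square matrix on `ℓ₂ⁿ`. -/
def opNorm22 {n : ℕ} (A : Matrix (Fin n) (Fin n) ℝ) : ℝ :=
  ‖Matrix.toEuclideanCLM (n := Fin n) (𝕜 := ℝ) A‖

/-- The largest Euclidean norm of a row. -/
def maxRowNorm {n : ℕ} (A : Matrix (Fin n) (Fin n) ℝ) : ℝ :=
  ⨆ i : Fin n, ‖(WithLp.toLp 2 (fun j => A i j) : EuclideanSpace ℝ (Fin n))‖

/-- The largest Euclidean norm of a column. -/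
def maxColNorm {n : ℕ} (A : Matrix (Fin n) (Fin n) ℝ) : ℝ :=
  ⨆ j : Fin n, ‖(WithLp.toLp 2 (fun i => A i j) : EuclideanSpace ℝ (Fin n))‖

end

open scoped Matrix.Norms.L2Operator

/-! ### Trace inequalities for real symmetric matrices. -/

section Trace

variable {m : Type*} [Fintype m] [DecidableEq m]

/-! For fixed signs, split the matrix as `U + W` by sign. The parts are independent and centred, so
`E‖U‖` and `E‖W‖` are at most `E‖U - W‖`: random signs cost a factor 2, without an independent copy
(`integral_norm_le_two_mul_integral_norm_signFlip`).

Averaging over signs leaves a bound for a fixed matrix. Its Hermitian dilation is a signed sum `S`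
of symmetric `H k` with `∑ H k ^ 2` diagonal, its entries being squared row and column norms.
Flipping one sign at a time bounds the mean of `tr S ^ (2p+2)` by `2(2p+1)s` times that of `tr S ^
(2p)` (`sum_trace_signedSum_pow_succ_le`); with `p` about `log n` the dimension factor is harmless
(`sum_norm_signedSum_le`).

This yields order `√(log n)`, stronger than the exponent 3/2. -/

lemma Matrix.IsHermitian.pow_eq_conj {A : Matrix m m ℝ} (hA : A.IsHermitian) (q : ℕ) :
    A ^ q = (hA.eigenvectorUnitary : Matrix m m ℝ) *
      Matrix.diagonal (fun i => hA.eigenvalues i ^ q) *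
        star (hA.eigenvectorUnitary : Matrix m m ℝ) := by
  conv_lhs => rw [hA.spectral_theorem]
  rw [← map_pow, Matrix.diagonal_pow, Unitary.conjStarAlgAut_apply]
  rfl

lemma Matrix.IsHermitian.trace_pow {A : Matrix m m ℝ} (hA : A.IsHermitian) (q : ℕ) :
    (A ^ q).trace = ∑ i, hA.eigenvalues i ^ q := by
  rw [hA.pow_eq_conj, Matrix.trace_mul_comm, ← mul_assoc]
  simp [Matrix.trace_diagonal]

lemma Matrix.IsHermitian.norm_pow_le_trace {A : Matrix m m ℝ} [Nonempty m] (hA : A.IsHermitian)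
    (p : ℕ) : ‖A‖ ^ (2 * p) ≤ (A ^ (2 * p)).trace := by
  -- The right side is the sup norm of the eigenvalue vector.
  have h : ‖A‖ = ‖hA.eigenvalues‖ := by
    have := hA.pow_eq_conj 1
    simp only [pow_one] at this
    conv_lhs => rw [this]
    rw [← Unitary.coe_star, CStarRing.norm_mul_coe_unitary, CStarRing.norm_coe_unitary_mul,
      Matrix.l2_opNorm_diagonal]
  obtain ⟨i, hi⟩ := Finite.exists_max fun i => ‖hA.eigenvalues i‖
  have h2 : ‖hA.eigenvalues‖ ≤ ‖hA.eigenvalues i‖ := (pi_norm_le_iff_of_nonneg (norm_nonneg _)).2 hi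
  rw [h, hA.trace_pow]
  calc ‖hA.eigenvalues‖ ^ (2 * p) ≤ ‖hA.eigenvalues i‖ ^ (2 * p) := by gcongr
    _ = hA.eigenvalues i ^ (2 * p) := by rw [Real.norm_eq_abs, (even_two_mul p).pow_abs]
    _ ≤ _ := Finset.single_le_sum (f := fun i => hA.eigenvalues i ^ (2 * p))
        (fun j _ => (even_two_mul p).pow_nonneg _) (Finset.mem_univ i)

lemma trace_transpose_mul_diagonal_mul_mul_diagonal (G : Matrix m m ℝ) (d e : m → ℝ) :
    (G.transpose * Matrix.diagonal d * G * Matrix.diagonal e).trace =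
      ∑ v, ∑ u, G u v ^ 2 * d u * e v := by
  simp only [Matrix.trace, Matrix.diag_apply, Matrix.mul_diagonal, Matrix.mul_apply (N := G),
    Matrix.transpose_apply, Finset.sum_mul]
  refine Finset.sum_congr rfl fun v _ => Finset.sum_congr rfl fun u _ => by ring

lemma trace_mul_pow_mul_pow {H A B : Matrix m m ℝ} (hH : H.IsHermitian) (hA : A.IsHermitian)
    (hB : B.IsHermitian) (q s : ℕ) :
    (H * A ^ q * H * B ^ s).trace =
      ∑ v, ∑ u, (star (hA.eigenvectorUnitary : Matrix m m ℝ) * H *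
        (hB.eigenvectorUnitary : Matrix m m ℝ)) u v ^ 2 *
          hA.eigenvalues u ^ q * hB.eigenvalues v ^ s := by
  rw [← trace_transpose_mul_diagonal_mul_mul_diagonal, hA.pow_eq_conj q, hB.pow_eq_conj s]
  set U := (hA.eigenvectorUnitary : Matrix m m ℝ)
  set W := (hB.eigenvectorUnitary : Matrix m m ℝ)
  have hT : (star U * H * W).transpose = star W * H * U := by
    have hH' : H.transpose = H := by simpa [Matrix.IsHermitian] using hH
    rw [Matrix.transpose_mul, Matrix.transpose_mul, hH', Matrix.star_eq_conjTranspose,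
      Matrix.star_eq_conjTranspose]
    simp [Matrix.conjTranspose_eq_transpose_of_trivial, mul_assoc]
  rw [hT]
  simp only [← mul_assoc]
  rw [Matrix.trace_mul_comm]
  simp only [← mul_assoc]

lemma abs_pow_mul_pow_le (a b : ℝ) {q r : ℕ} (hq : q ≤ r) (hr : Even r) :
    a ^ q * b ^ (r - q) ≤ a ^ r + b ^ r := by
  have h1 : a ^ q * b ^ (r - q) ≤ |a| ^ q * |b| ^ (r - q) := by
    rw [← abs_pow, ← abs_pow, ← abs_mul]; exact le_abs_self _
  rw [← hr.pow_abs a, ← hr.pow_abs b]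
  rcases le_total |a| |b| with h | h
  · calc _ ≤ _ := h1
      _ ≤ |b| ^ q * |b| ^ (r - q) := by gcongr
      _ = |b| ^ r := by rw [← pow_add]; congr 1; omega
      _ ≤ _ := le_add_of_nonneg_left (by positivity)
  · calc _ ≤ _ := h1
      _ ≤ |a| ^ q * |a| ^ (r - q) := by gcongr
      _ = |a| ^ r := by rw [← pow_add]; congr 1; omega
      _ ≤ _ := le_add_of_nonneg_right (by positivity)

/-- In eigenbases of `A` and `B` all three traces are sums with the same nonnegative weights, so the
scalar inequality suffices although `A` and `B` need not commute. -/
lemma trace_mul_pow_mul_pow_le {H A B : Matrix m m ℝ} (hH : H.IsHermitian) (hA : A.IsHermitian)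
    (hB : B.IsHermitian) {q r : ℕ} (hq : q ≤ r) (hr : Even r) :
    (H * A ^ q * H * B ^ (r - q)).trace ≤
      (H * H * A ^ r).trace + (H * H * B ^ r).trace := by
  have eA : (H * H * A ^ r).trace = (H * A ^ r * H * B ^ 0).trace := by
    rw [pow_zero, mul_one, Matrix.trace_mul_comm (H * A ^ r), ← mul_assoc]
  have eB : (H * H * B ^ r).trace = (H * A ^ 0 * H * B ^ r).trace := by
    rw [pow_zero, mul_one]
  rw [eA, eB]
  simp only [trace_mul_pow_mul_pow hH hA hB, ← Finset.sum_add_distrib]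
  refine Finset.sum_le_sum fun v _ => Finset.sum_le_sum fun u _ => ?_
  rw [pow_zero, pow_zero, mul_one, mul_one, mul_assoc, ← mul_add]
  exact mul_le_mul_of_nonneg_left (abs_pow_mul_pow_le _ _ hq hr) (sq_nonneg _)

lemma pow_succ_sub_pow_succ {R : Type*} [Ring R] (a b : R) (r : ℕ) :
    a ^ (r + 1) - b ^ (r + 1) = ∑ q ∈ Finset.range (r + 1), a ^ q * (a - b) * b ^ (r - q) := by
  induction r with
  | zero => simp
  | succ r ih =>
    rw [Finset.sum_range_succ]
    have : ∑ q ∈ Finset.range (r + 1), a ^ q * (a - b) * b ^ (r + 1 - q) =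
        (a ^ (r + 1) - b ^ (r + 1)) * b := by
      rw [ih, Finset.sum_mul]
      refine Finset.sum_congr rfl fun q hq => ?_
      rw [mul_assoc _ (b ^ _), ← pow_succ]
      congr 2
      have := Finset.mem_range.1 hq
      omega
    rw [this]
    simp only [Nat.sub_self, pow_zero, mul_one, pow_succ _ (r + 1)]
    noncomm_ring

/-- `Y ^ r * (s - V) * Y ^ r` is positive semidefinite, so its trace is nonnegative. -/
lemma trace_mul_pow_le_of_posSemidef {V Y : Matrix m m ℝ} {s : ℝ}
    (hV : (s • (1 : Matrix m m ℝ) - V).PosSemidef) (hY : Y.IsHermitian) (r : ℕ) :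
    (V * Y ^ (2 * r)).trace ≤ s * (Y ^ (2 * r)).trace := by
  have h := (hV.conjTranspose_mul_mul_same (Y ^ r)).trace_nonneg
  rw [(hY.pow r).eq, Matrix.trace_mul_comm, ← mul_assoc, ← pow_add, ← two_mul, mul_sub,
    Matrix.trace_sub, mul_smul_comm, mul_one, Matrix.trace_smul, smul_eq_mul,
    Matrix.trace_mul_comm _ V] at h
  linarith

end Trace

/-! ### Noncommutative Khintchine inequality by sign flips. -/

section Khintchine

variable {m : Type*} {ι : Type*} [Fintype ι]

/-- The sum of the matrices `H k` with signs `ε k`. -/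
def signedSum (H : ι → Matrix m m ℝ) (ε : ι → ℤˣ) : Matrix m m ℝ :=
  ∑ k, ((ε k : ℤ) : ℝ) • H k

lemma signedSum_isHermitian {H : ι → Matrix m m ℝ} (hH : ∀ k, (H k).IsHermitian) (ε : ι → ℤˣ) :
    (signedSum H ε).IsHermitian := by
  unfold signedSum Matrix.IsHermitian
  rw [Matrix.conjTranspose_sum]
  exact Finset.sum_congr rfl fun k _ => by rw [Matrix.conjTranspose_smul, (hH k).eq]; simp

/-- Flipping the sign with index `k`. -/
def flipSign {ι : Type*} [DecidableEq ι] (k : ι) : Equiv.Perm (ι → ℤˣ) :=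
  Function.Involutive.toPerm (fun ε => Function.update ε k (-ε k)) fun ε => by simp

lemma flipSign_apply_same {ι : Type*} [DecidableEq ι] (k : ι) (ε : ι → ℤˣ) : flipSign k ε k = -ε k := by
  simp [flipSign, Function.Involutive.toPerm]

lemma signedSum_sub_signedSum_flipSign [DecidableEq ι] (H : ι → Matrix m m ℝ) (ε : ι → ℤˣ) (k : ι) :
    signedSum H ε - signedSum H (flipSign k ε) = (2 * ((ε k : ℤ) : ℝ)) • H k := by
  unfold signedSum
  rw [← Finset.sum_sub_distrib, Finset.sum_eq_single k]
  · rw [flipSign_apply_same, ← sub_smul]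
    push_cast
    congr 1
    ring
  · intro j _ hj
    simp [flipSign, Function.Involutive.toPerm, Function.update_of_ne hj]
  · simp

lemma units_cast_mul_self (u : ℤˣ) : ((u : ℤ) : ℝ) * ((u : ℤ) : ℝ) = 1 := by
  rcases Int.units_eq_one_or u with rfl | rfl <;> simp

variable [Fintype m] [DecidableEq m] [DecidableEq ι]

/-- A discrete integration by parts: flipping sign `k` negates the left sum, so twice it is a sum of
differences of powers, which telescope into `r + 1` terms each containing a second `H k`. -/
lemma sum_sign_mul_trace_le {H : ι → Matrix m m ℝ} (hH : ∀ k, (H k).IsHermitian) (k : ι)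
    {r : ℕ} (hr : Even r) :
    ∑ ε : ι → ℤˣ, ((ε k : ℤ) : ℝ) * (H k * signedSum H ε ^ (r + 1)).trace ≤
      2 * (r + 1) * ∑ ε : ι → ℤˣ, (H k * H k * signedSum H ε ^ r).trace := by
  have hflip : ∑ ε : ι → ℤˣ, ((ε k : ℤ) : ℝ) * (H k * signedSum H ε ^ (r + 1)).trace =
      -∑ ε : ι → ℤˣ, ((ε k : ℤ) : ℝ) * (H k * signedSum H (flipSign k ε) ^ (r + 1)).trace := by
    rw [← Equiv.sum_comp (flipSign k), ← Finset.sum_neg_distrib]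
    refine Finset.sum_congr rfl fun ε _ => ?_
    rw [flipSign_apply_same]
    push_cast
    ring
  have hpt (ε : ι → ℤˣ) :
      ((ε k : ℤ) : ℝ) * (H k * signedSum H ε ^ (r + 1)).trace -
        ((ε k : ℤ) : ℝ) * (H k * signedSum H (flipSign k ε) ^ (r + 1)).trace ≤
      2 * (r + 1) * ((H k * H k * signedSum H ε ^ r).trace +
        (H k * H k * signedSum H (flipSign k ε) ^ r).trace) := by
    rw [← mul_sub, ← Matrix.trace_sub, ← mul_sub, pow_succ_sub_pow_succ,
      signedSum_sub_signedSum_flipSign, Finset.mul_sum, Matrix.trace_sum, Finset.mul_sum]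
    calc _ = ∑ q ∈ Finset.range (r + 1), 2 * (H k * signedSum H ε ^ q * H k *
          signedSum H (flipSign k ε) ^ (r - q)).trace := by
          refine Finset.sum_congr rfl fun q _ => ?_
          rw [mul_smul_comm, smul_mul_assoc, mul_smul_comm, Matrix.trace_smul, smul_eq_mul]
          simp only [← mul_assoc]
          linear_combination 2 * (H k * signedSum H ε ^ q * H k *
            signedSum H (flipSign k ε) ^ (r - q)).trace * units_cast_mul_self (ε k)
      _ ≤ ∑ q ∈ Finset.range (r + 1), 2 * ((H k * H k * signedSum H ε ^ r).trace +
        (H k * H k * signedSum H (flipSign k ε) ^ r).trace) := by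
          refine Finset.sum_le_sum fun q hq => ?_
          have := trace_mul_pow_mul_pow_le (hH k) (signedSum_isHermitian hH ε)
            (signedSum_isHermitian hH (flipSign k ε))
            (Nat.lt_succ_iff.1 (Finset.mem_range.1 hq)) hr
          linarith
      _ = _ := by rw [Finset.sum_const, Finset.card_range, nsmul_eq_mul]; push_cast; ring
  have hsum := Finset.sum_le_sum fun ε (_ : ε ∈ Finset.univ) => hpt ε
  rw [Finset.sum_sub_distrib, ← Finset.mul_sum, Finset.sum_add_distrib,
    Equiv.sum_comp (flipSign k) fun ε => (H k * H k * signedSum H ε ^ r).trace] at hsum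
  linarith

lemma sum_trace_signedSum_pow_succ_le {H : ι → Matrix m m ℝ} (hH : ∀ k, (H k).IsHermitian) {s : ℝ}
    (hs : (s • (1 : Matrix m m ℝ) - ∑ k, H k * H k).PosSemidef) (p : ℕ) :
    ∑ ε : ι → ℤˣ, (signedSum H ε ^ (2 * (p + 1))).trace ≤
      2 * (2 * p + 1) * s * ∑ ε : ι → ℤˣ, (signedSum H ε ^ (2 * p)).trace := by
  calc ∑ ε : ι → ℤˣ, (signedSum H ε ^ (2 * (p + 1))).trace
      = ∑ k, ∑ ε : ι → ℤˣ, ((ε k : ℤ) : ℝ) * (H k * signedSum H ε ^ (2 * p + 1)).trace := by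
        rw [Finset.sum_comm]
        refine Finset.sum_congr rfl fun ε _ => ?_
        rw [show 2 * (p + 1) = 2 * p + 1 + 1 by ring, pow_succ' _ (2 * p + 1)]
        conv_lhs => enter [1, 1]; rw [signedSum]
        simp only [Finset.sum_mul, Matrix.trace_sum, smul_mul_assoc, Matrix.trace_smul, smul_eq_mul]
    _ ≤ ∑ k, 2 * (2 * p + 1) * ∑ ε : ι → ℤˣ, (H k * H k * signedSum H ε ^ (2 * p)).trace := by
        refine Finset.sum_le_sum fun k _ => ?_
        exact_mod_cast sum_sign_mul_trace_le hH k (even_two_mul p)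
    _ = 2 * (2 * p + 1) * ∑ ε : ι → ℤˣ, ((∑ k, H k * H k) * signedSum H ε ^ (2 * p)).trace := by
        rw [← Finset.mul_sum, Finset.sum_comm]
        simp only [Finset.sum_mul, Matrix.trace_sum]
    _ ≤ 2 * (2 * p + 1) * ∑ ε : ι → ℤˣ, s * (signedSum H ε ^ (2 * p)).trace := by
        gcongr with ε
        exact trace_mul_pow_le_of_posSemidef hs (signedSum_isHermitian hH ε) p
    _ = _ := by rw [← Finset.mul_sum]; ring

/-- With `P` fixed during the induction, every step costs at most the same factor `4 * P * s`. -/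
lemma sum_trace_signedSum_pow_le {H : ι → Matrix m m ℝ} (hH : ∀ k, (H k).IsHermitian) {s : ℝ}
    (hs0 : 0 ≤ s) (hs : (s • (1 : Matrix m m ℝ) - ∑ k, H k * H k).PosSemidef) {p P : ℕ}
    (hp : p ≤ P) :
    ∑ ε : ι → ℤˣ, (signedSum H ε ^ (2 * p)).trace ≤
      (4 * P * s) ^ p * (Fintype.card m * Fintype.card (ι → ℤˣ)) := by
  induction p with
  | zero => simp [Matrix.trace_one, mul_comm]
  | succ p ih =>
    have hP : (p : ℝ) + 1 ≤ P := by exact_mod_cast hp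
    have h0 : 0 ≤ ∑ ε : ι → ℤˣ, (signedSum H ε ^ (2 * p)).trace :=
      Finset.sum_nonneg fun ε _ => by
        rw [(signedSum_isHermitian hH ε).trace_pow]
        exact Finset.sum_nonneg fun i _ => (even_two_mul p).pow_nonneg _
    calc _ ≤ _ := sum_trace_signedSum_pow_succ_le hH hs p
      _ ≤ (4 * P * s) * ∑ ε : ι → ℤˣ, (signedSum H ε ^ (2 * p)).trace := by
          gcongr ?_ * _
          nlinarith
      _ ≤ (4 * P * s) * ((4 * P * s) ^ p * (Fintype.card m * Fintype.card (ι → ℤˣ))) := by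
          gcongr
          exact ih (by omega)
      _ = _ := by ring

/-- A noncommutative Khintchine inequality. -/
theorem sum_norm_signedSum_le [Nonempty m] {H : ι → Matrix m m ℝ} (hH : ∀ k, (H k).IsHermitian)
    {s : ℝ} (hs0 : 0 ≤ s) (hs : (s • (1 : Matrix m m ℝ) - ∑ k, H k * H k).PosSemidef) {p : ℕ}
    (hp : p ≠ 0) (hm : Fintype.card m ≤ 4 ^ p) :
    ∑ ε : ι → ℤˣ, ‖signedSum H ε‖ ≤ 4 * √p * √s * Fintype.card (ι → ℤˣ) := by
  have hN : (0 : ℝ) < Fintype.card (ι → ℤˣ) := by exact_mod_cast Fintype.card_pos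
  rw [← div_le_iff₀ hN]
  refine le_of_pow_le_pow_left₀ (n := 2 * p) (by omega) (by positivity) ?_
  have hm' : (Fintype.card m : ℝ) ≤ 4 ^ p := by exact_mod_cast hm
  -- Jensen's inequality for the uniform measure on signs.
  have h1 : (∑ ε : ι → ℤˣ, ‖signedSum H ε‖ / Fintype.card (ι → ℤˣ)) ^ (2 * p) ≤
      ∑ ε : ι → ℤˣ, ‖signedSum H ε‖ ^ (2 * p) / Fintype.card (ι → ℤˣ) := by
    have := Real.pow_arith_mean_le_arith_mean_pow Finset.univ
      (fun _ : ι → ℤˣ => (Fintype.card (ι → ℤˣ) : ℝ)⁻¹) (fun ε => ‖signedSum H ε‖)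
      (fun _ _ => by positivity)
      (by rw [Finset.sum_const, Finset.card_univ, nsmul_eq_mul]; exact mul_inv_cancel₀ hN.ne')
      (fun _ _ => norm_nonneg _) (2 * p)
    simpa only [inv_mul_eq_div] using this
  rw [Finset.sum_div]
  refine h1.trans ?_
  rw [← Finset.sum_div, div_le_iff₀ hN]
  calc ∑ ε : ι → ℤˣ, ‖signedSum H ε‖ ^ (2 * p)
      ≤ ∑ ε : ι → ℤˣ, (signedSum H ε ^ (2 * p)).trace :=
        Finset.sum_le_sum fun ε _ => (signedSum_isHermitian hH ε).norm_pow_le_trace p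
    _ ≤ (4 * p * s) ^ p * (Fintype.card m * Fintype.card (ι → ℤˣ)) :=
        sum_trace_signedSum_pow_le hH hs0 hs le_rfl
    _ ≤ (4 * p * s) ^ p * (4 ^ p * Fintype.card (ι → ℤˣ)) := by gcongr
    _ = (4 * √p * √s) ^ (2 * p) * Fintype.card (ι → ℤˣ) := by
        rw [pow_mul (4 * √p * √s), show (4 * √(p : ℝ) * √s) ^ 2 = 4 * p * s * 4 by
          rw [mul_pow, mul_pow, Real.sq_sqrt (Nat.cast_nonneg p), Real.sq_sqrt hs0]; ring,
          mul_pow _ (4 : ℝ), mul_assoc (_ ^ p)]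

end Khintchine

/-! ### Hermitian dilation and the bound for a fixed matrix. -/

section Dilation

variable {n : ℕ}

/-- The matrix `A` with its entries multiplied by the signs `ε`. -/
def signFlip (A : Matrix (Fin n) (Fin n) ℝ) (ε : Fin n × Fin n → ℤˣ) : Matrix (Fin n) (Fin n) ℝ :=
  Matrix.of fun i j => ((ε (i, j) : ℤ) : ℝ) * A i j

/-- The Hermitian dilation of a single entry of `A`. -/
def entryDilation (A : Matrix (Fin n) (Fin n) ℝ) (k : Fin n × Fin n) :
    Matrix (Fin n ⊕ Fin n) (Fin n ⊕ Fin n) ℝ :=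
  Matrix.fromBlocks 0 (Matrix.single k.1 k.2 (A k.1 k.2)) (Matrix.single k.2 k.1 (A k.1 k.2)) 0

lemma entryDilation_isHermitian (A : Matrix (Fin n) (Fin n) ℝ) (k : Fin n × Fin n) :
    (entryDilation A k).IsHermitian := by
  simp [Matrix.IsHermitian, entryDilation, Matrix.fromBlocks_transpose]

lemma sum_fromBlocks {ι l m o q R : Type*} [AddCommMonoid R] (s : Finset ι)
    (A : ι → Matrix l m R) (B : ι → Matrix l q R) (C : ι → Matrix o m R) (D : ι → Matrix o q R) :
    ∑ k ∈ s, Matrix.fromBlocks (A k) (B k) (C k) (D k) =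
      Matrix.fromBlocks (∑ k ∈ s, A k) (∑ k ∈ s, B k) (∑ k ∈ s, C k) (∑ k ∈ s, D k) := by
  ext (i | i) (j | j) <;> simp [Matrix.sum_apply]

lemma sum_entryDilation_mul_self (A : Matrix (Fin n) (Fin n) ℝ) :
    ∑ k, entryDilation A k * entryDilation A k =
      Matrix.diagonal (Sum.elim (fun i => ∑ j, A i j ^ 2) (fun j => ∑ i, A i j ^ 2)) := by
  simp only [entryDilation, Matrix.fromBlocks_multiply, Matrix.single_mul_single_same, zero_mul,
    mul_zero, zero_add, add_zero, sum_fromBlocks, Finset.sum_const_zero,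
    ← Matrix.fromBlocks_diagonal]
  simp only [← sq]
  congr 1
  · ext a b
    rcases eq_or_ne a b with rfl | h
    · simp [Fintype.sum_prod_type, Matrix.sum_apply, Matrix.single_apply]
    · simp only [Matrix.sum_apply, Matrix.single_apply, Matrix.diagonal_apply_ne _ h]
      exact Finset.sum_eq_zero fun k _ => if_neg fun hk => h (hk.1.symm.trans hk.2)
  · ext a b
    rcases eq_or_ne a b with rfl | h
    · simp [Fintype.sum_prod_type_right, Matrix.sum_apply, Matrix.single_apply]
    · simp only [Matrix.sum_apply, Matrix.single_apply, Matrix.diagonal_apply_ne _ h]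
      exact Finset.sum_eq_zero fun k _ => if_neg fun hk => h (hk.1.symm.trans hk.2)

lemma signedSum_entryDilation (A : Matrix (Fin n) (Fin n) ℝ) (ε : Fin n × Fin n → ℤˣ) :
    signedSum (entryDilation A) ε =
      Matrix.fromBlocks 0 (signFlip A ε) (signFlip A ε).transpose 0 := by
  simp only [signedSum, entryDilation, Matrix.fromBlocks_smul, sum_fromBlocks, smul_zero,
    Finset.sum_const_zero, Matrix.smul_single, smul_eq_mul]
  congr 1
  · ext a b
    simp [Fintype.sum_prod_type, Matrix.sum_apply, Matrix.single_apply, signFlip, ite_and]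
  · ext a b
    simp [Fintype.sum_prod_type, Matrix.sum_apply, Matrix.single_apply, signFlip, ite_and]

/-- The dilation maps `(0, x)` to `(A x, 0)`. -/
lemma norm_le_norm_fromBlocks (A : Matrix (Fin n) (Fin n) ℝ) :
    ‖A‖ ≤ ‖Matrix.fromBlocks 0 A A.transpose 0‖ := by
  rw [Matrix.cstar_norm_def A]
  refine ContinuousLinearMap.opNorm_le_bound _ (norm_nonneg _) fun x => ?_
  have h := Matrix.l2_opNorm_mulVec (Matrix.fromBlocks 0 A A.transpose 0)
    (WithLp.toLp 2 (Sum.elim 0 x.ofLp) : EuclideanSpace ℝ (Fin n ⊕ Fin n))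
  have e1 : ‖(WithLp.toLp 2 (Sum.elim 0 x.ofLp) : EuclideanSpace ℝ (Fin n ⊕ Fin n))‖ = ‖x‖ := by
    simp [EuclideanSpace.norm_eq, Fintype.sum_sum_type]
  have e2 : ‖Matrix.toEuclideanCLM (n := Fin n) (𝕜 := ℝ) A x‖ ≤
      ‖(WithLp.toLp 2 ((Matrix.fromBlocks 0 A A.transpose 0).mulVec
        (Sum.elim 0 x.ofLp)) : EuclideanSpace ℝ (Fin n ⊕ Fin n))‖ := by
    rw [Matrix.fromBlocks_mulVec]
    simp [EuclideanSpace.norm_eq, Fintype.sum_sum_type, Matrix.ofLp_toEuclideanCLM]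
  rw [e1] at h
  exact e2.trans h

lemma sum_row_sq_le (A : Matrix (Fin n) (Fin n) ℝ) (i : Fin n) :
    ∑ j, A i j ^ 2 ≤ maxRowNorm A ^ 2 := by
  have h : ‖(WithLp.toLp 2 (fun j => A i j) : EuclideanSpace ℝ (Fin n))‖ ≤ maxRowNorm A :=
    le_ciSup (f := fun i => ‖(WithLp.toLp 2 (fun j => A i j) : EuclideanSpace ℝ (Fin n))‖)
      (Set.finite_range _).bddAbove i
  calc _ = ‖(WithLp.toLp 2 (fun j => A i j) : EuclideanSpace ℝ (Fin n))‖ ^ 2 := by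
        simp [EuclideanSpace.norm_sq_eq]
    _ ≤ _ := by gcongr

lemma maxColNorm_eq_maxRowNorm_transpose (A : Matrix (Fin n) (Fin n) ℝ) :
    maxColNorm A = maxRowNorm A.transpose := rfl

lemma maxRowNorm_nonneg (A : Matrix (Fin n) (Fin n) ℝ) : 0 ≤ maxRowNorm A :=
  Real.iSup_nonneg fun _ => norm_nonneg _

lemma maxColNorm_nonneg (A : Matrix (Fin n) (Fin n) ℝ) : 0 ≤ maxColNorm A :=
  maxRowNorm_nonneg A.transpose

lemma sum_norm_signFlip_le (hn : 2 ≤ n) (A : Matrix (Fin n) (Fin n) ℝ) :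
    ∑ ε : Fin n × Fin n → ℤˣ, ‖signFlip A ε‖ ≤
      4 * √(Nat.clog 2 n : ℝ) * (maxRowNorm A + maxColNorm A) *
        Fintype.card (Fin n × Fin n → ℤˣ) := by
  have hr := maxRowNorm_nonneg A
  have hc := maxColNorm_nonneg A
  have : Nonempty (Fin n ⊕ Fin n) := ⟨Sum.inl ⟨0, by omega⟩⟩
  have hs : ((maxRowNorm A + maxColNorm A) ^ 2 • (1 : Matrix (Fin n ⊕ Fin n) (Fin n ⊕ Fin n) ℝ) -
      ∑ k, entryDilation A k * entryDilation A k).PosSemidef := by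
    rw [sum_entryDilation_mul_self, Matrix.smul_one_eq_diagonal, Matrix.diagonal_sub]
    refine Matrix.PosSemidef.diagonal ?_
    rintro (i | j)
    · have := sum_row_sq_le A i
      simp only [Pi.zero_apply, Sum.elim_inl]
      nlinarith
    · have := sum_row_sq_le A.transpose j
      rw [← maxColNorm_eq_maxRowNorm_transpose] at this
      simp only [Matrix.transpose_apply] at this
      simp only [Pi.zero_apply, Sum.elim_inr]
      nlinarith
  -- Since `n ≥ 2`, the dimension satisfies `2n ≤ n ^ 2`.
  have hcard : Fintype.card (Fin n ⊕ Fin n) ≤ 4 ^ Nat.clog 2 n := by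
    have h : n ≤ 2 ^ Nat.clog 2 n := Nat.le_pow_clog (by norm_num) n
    rw [Fintype.card_sum, Fintype.card_fin, show 4 = 2 ^ 2 by norm_num, pow_right_comm]
    nlinarith
  have key := sum_norm_signedSum_le (entryDilation_isHermitian A) (sq_nonneg _) hs
    (Nat.clog_pos (by norm_num) hn).ne' hcard
  rw [Real.sqrt_sq (by positivity)] at key
  refine (Finset.sum_le_sum fun ε _ => ?_).trans key
  rw [signedSum_entryDilation]
  exact norm_le_norm_fromBlocks _

end Dilation

/-! ### Symmetrization of the random matrix. -/

section Symmetrization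

/-- Adding an independent centred vector does not decrease the expected norm. -/
lemma integral_norm_le_integral_norm_add {Ω E : Type*} [MeasurableSpace Ω] {μ : Measure Ω}
    [IsProbabilityMeasure μ] [NormedAddCommGroup E] [NormedSpace ℝ E] [CompleteSpace E]
    [MeasurableSpace E] [BorelSpace E] [SecondCountableTopology E] {U W : Ω → E}
    (hUW : IndepFun U W μ) (hU : Integrable U μ) (hW : Integrable W μ) (hW0 : ∫ ω, W ω ∂μ = 0) :
    ∫ ω, ‖U ω‖ ∂μ ≤ ∫ ω, ‖U ω + W ω‖ ∂μ := by
  have hUm := hU.1.aemeasurable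
  have hWm := hW.1.aemeasurable
  have := Measure.isProbabilityMeasure_map (μ := μ) hUm
  have := Measure.isProbabilityMeasure_map (μ := μ) hWm
  have hprod := (indepFun_iff_map_prod_eq_prod_map_map hUm hWm).1 hUW
  have hWi : Integrable (fun w : E => w) (μ.map W) :=
    (integrable_map_measure aestronglyMeasurable_id hWm).2 hW
  have hUi : Integrable (fun u : E => u) (μ.map U) :=
    (integrable_map_measure aestronglyMeasurable_id hUm).2 hU
  have hW1 : ∫ w, w ∂(μ.map W) = 0 := by
    exact (integral_map hWm (f := fun w => w) aestronglyMeasurable_id).trans hW0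
  have hsum : Integrable (fun z : E × E => ‖z.1 + z.2‖) ((μ.map U).prod (μ.map W)) :=
    ((hUi.comp_fst _).add (hWi.comp_snd _)).norm
  have hm : Measurable fun z : E × E => ‖z.1 + z.2‖ := by fun_prop
  calc ∫ ω, ‖U ω‖ ∂μ = ∫ u, ‖u‖ ∂(μ.map U) :=
        (integral_map hUm continuous_norm.aestronglyMeasurable).symm
    _ ≤ ∫ u, ∫ w, ‖u + w‖ ∂(μ.map W) ∂(μ.map U) := by
        refine integral_mono hUi.norm hsum.integral_prod_left fun u => ?_
        -- Jensen's inequality in `w` for fixed `u`.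
        have h : ∫ w, (u + w) ∂(μ.map W) = u := by
          rw [integral_add (integrable_const _) hWi, hW1]; simp
        calc ‖u‖ = ‖∫ w, (u + w) ∂(μ.map W)‖ := by rw [h]
          _ ≤ _ := norm_integral_le_integral_norm _
    _ = ∫ z, ‖z.1 + z.2‖ ∂((μ.map U).prod (μ.map W)) := (integral_prod _ hsum).symm
    _ = ∫ ω, ‖U ω + W ω‖ ∂μ := by
        rw [← hprod, integral_map (hUm.prodMk hWm) hm.aestronglyMeasurable]

instance Matrix.borelMeasurableSpace {n : ℕ} : MeasurableSpace (Matrix (Fin n) (Fin n) ℝ) :=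
  borel _

instance Matrix.borelSpace {n : ℕ} : BorelSpace (Matrix (Fin n) (Fin n) ℝ) := ⟨rfl⟩

variable {n : ℕ} {Ω : Type*} [MeasurableSpace Ω] {μ : Measure Ω}

/-- The random matrix with entries `X i j` at the positions in `S` and zeros elsewhere. -/
def restrictEntries (X : Fin n → Fin n → Ω → ℝ) (S : Finset (Fin n × Fin n)) (ω : Ω) :
    Matrix (Fin n) (Fin n) ℝ :=
  Matrix.of fun i j => if (i, j) ∈ S then X i j ω else 0

lemma integrable_matrix {M : Ω → Matrix (Fin n) (Fin n) ℝ}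
    (hM : ∀ i j, Integrable (fun ω => M ω i j) μ) : Integrable M μ := by
  have h : M = fun ω => ∑ i, ∑ j, M ω i j • Matrix.single i j (1 : ℝ) := by
    ext1 ω
    conv_lhs => rw [Matrix.matrix_eq_sum_single (M ω)]
    simp [Matrix.smul_single]
  rw [h]
  exact integrable_finsetSum _ fun i _ => integrable_finsetSum _ fun j _ => (hM i j).smul_const _

lemma integral_matrix_apply {M : Ω → Matrix (Fin n) (Fin n) ℝ} (hM : Integrable M μ)
    (i j : Fin n) : (∫ ω, M ω ∂μ) i j = ∫ ω, M ω i j ∂μ := by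
  have := (LinearMap.toContinuousLinearMap
    (Matrix.entryLinearMap ℝ ℝ i j : Matrix (Fin n) (Fin n) ℝ →ₗ[ℝ] ℝ)).integral_comp_comm hM
  simpa using this.symm

variable {X : Fin n → Fin n → Ω → ℝ}

lemma integrable_restrictEntries (hX : ∀ i j, Integrable (X i j) μ)
    (S : Finset (Fin n × Fin n)) : Integrable (restrictEntries X S) μ := by
  refine integrable_matrix fun i j => ?_
  simp only [restrictEntries, Matrix.of_apply]
  split_ifs
  · exact hX i j
  · simp

lemma integral_restrictEntries (hX : ∀ i j, Integrable (X i j) μ)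
    (h0 : ∀ i j, ∫ ω, X i j ω ∂μ = 0) (S : Finset (Fin n × Fin n)) :
    ∫ ω, restrictEntries X S ω ∂μ = 0 := by
  ext i j
  rw [integral_matrix_apply (integrable_restrictEntries hX S)]
  simp only [restrictEntries, Matrix.of_apply]
  split_ifs
  · exact h0 i j
  · simp

lemma indepFun_restrictEntries (hind : iIndepFun (fun p : Fin n × Fin n => X p.1 p.2) μ)
    (hX : ∀ i j, Integrable (X i j) μ) {S T : Finset (Fin n × Fin n)} (hST : Disjoint S T) :
    IndepFun (restrictEntries X S) (restrictEntries X T) μ := by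
  have h := hind.indepFun_finset₀ S T hST fun p => (hX p.1 p.2).1.aemeasurable
  have hm (S : Finset (Fin n × Fin n)) : Measurable fun (f : S → ℝ) =>
      (Matrix.of fun i j => if h : (i, j) ∈ S then f ⟨(i, j), h⟩ else 0 :
        Matrix (Fin n) (Fin n) ℝ) := by
    refine (continuous_matrix fun i j => ?_).measurable
    by_cases hS : (i, j) ∈ S
    · simpa [hS] using continuous_apply _
    · simpa [hS] using continuous_const
  have h' := h.comp (hm S) (hm T)
  convert h' using 1
  all_goals ext ω i j; simp [restrictEntries]

lemma integral_norm_le_two_mul_integral_norm_signFlip [IsProbabilityMeasure μ]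
    (hind : iIndepFun (fun p : Fin n × Fin n => X p.1 p.2) μ) (hX : ∀ i j, Integrable (X i j) μ)
    (h0 : ∀ i j, ∫ ω, X i j ω ∂μ = 0) (ε : Fin n × Fin n → ℤˣ) :
    ∫ ω, ‖Matrix.of fun i j => X i j ω‖ ∂μ ≤
      2 * ∫ ω, ‖signFlip (Matrix.of fun i j => X i j ω) ε‖ ∂μ := by
  set S : Finset (Fin n × Fin n) := {p | ε p = 1} with hS
  set U := restrictEntries X S with hU
  set W := restrictEntries X Sᶜ with hW
  have hadd (ω : Ω) : (Matrix.of fun i j => X i j ω) = U ω + W ω := by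
    ext i j
    by_cases h : ε (i, j) = 1 <;> simp [hU, hW, restrictEntries, hS, h]
  have hsub (ω : Ω) : signFlip (Matrix.of fun i j => X i j ω) ε = U ω - W ω := by
    ext i j
    rcases Int.units_eq_one_or (ε (i, j)) with h | h <;>
      simp [hU, hW, restrictEntries, hS, h, signFlip]
  have hUi := integrable_restrictEntries hX S
  have hWi := integrable_restrictEntries hX Sᶜ
  have hi := indepFun_restrictEntries hind hX (disjoint_compl_right (a := S))
  have hi1 : IndepFun U (-W) μ := hi.comp measurable_id measurable_neg
  have hi2 : IndepFun (-W) U μ := hi1.symm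
  have k1 := integral_norm_le_integral_norm_add hi1 hUi hWi.neg
    (by simp [integral_neg, hW, integral_restrictEntries hX h0])
  have k2 := integral_norm_le_integral_norm_add hi2 hWi.neg hUi
    (integral_restrictEntries hX h0 S)
  simp only [hsub]
  simp only [hadd]
  simp only [Pi.neg_apply, norm_neg, ← sub_eq_add_neg] at k1 k2
  simp only [neg_add_eq_sub] at k2
  calc ∫ ω, ‖U ω + W ω‖ ∂μ ≤ ∫ ω, (‖U ω‖ + ‖W ω‖) ∂μ :=
        integral_mono (hUi.add hWi).norm (hUi.norm.add hWi.norm) fun ω => norm_add_le _ _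
    _ = ∫ ω, ‖U ω‖ ∂μ + ∫ ω, ‖W ω‖ ∂μ := integral_add hUi.norm hWi.norm
    _ ≤ _ := by rw [two_mul]; exact add_le_add k1 k2

lemma integrable_maxRowNorm {M : Ω → Matrix (Fin n) (Fin n) ℝ}
    (hM : ∀ i j, Integrable (fun ω => M ω i j) μ) : Integrable (fun ω => maxRowNorm (M ω)) μ := by
  have hrow (i : Fin n) : Integrable
      (fun ω => ‖(WithLp.toLp 2 (fun j => M ω i j) : EuclideanSpace ℝ (Fin n))‖) μ := by
    have h : (fun ω => (WithLp.toLp 2 (fun j => M ω i j) : EuclideanSpace ℝ (Fin n))) =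
        fun ω => ∑ j, M ω i j • EuclideanSpace.single j (1 : ℝ) := by
      ext ω j
      simp [Finset.sum_apply, Pi.single_apply]
    exact Integrable.norm (h ▸ integrable_finsetSum _ fun j _ => (hM i j).smul_const _)
  have hm : AEMeasurable (fun ω => maxRowNorm (M ω)) μ :=
    AEMeasurable.iSup fun i => (hrow i).1.aemeasurable
  refine (integrable_finsetSum Finset.univ fun i _ => hrow i).mono' hm.aestronglyMeasurable
    (Filter.Eventually.of_forall fun ω => ?_)
  rw [Real.norm_of_nonneg (maxRowNorm_nonneg _)]
  refine Real.iSup_le (fun i => ?_) (Finset.sum_nonneg fun _ _ => norm_nonneg _)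
  exact Finset.single_le_sum
    (f := fun i => ‖(WithLp.toLp 2 (fun j => M ω i j) : EuclideanSpace ℝ (Fin n))‖)
    (fun _ _ => norm_nonneg _) (Finset.mem_univ i)

/-- The bound with the order `√(log n)` of the noncommutative Khintchine inequality. -/
lemma integral_norm_le_sqrt_clog [IsProbabilityMeasure μ] (hn : 2 ≤ n)
    (hind : iIndepFun (fun p : Fin n × Fin n => X p.1 p.2) μ) (hX : ∀ i j, Integrable (X i j) μ)
    (h0 : ∀ i j, ∫ ω, X i j ω ∂μ = 0) :
    ∫ ω, ‖Matrix.of fun i j => X i j ω‖ ∂μ ≤ 8 * √(Nat.clog 2 n : ℝ) *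
      (∫ ω, maxRowNorm (Matrix.of fun i j => X i j ω) ∂μ +
        ∫ ω, maxColNorm (Matrix.of fun i j => X i j ω) ∂μ) := by
  have hN : (0 : ℝ) < Fintype.card (Fin n × Fin n → ℤˣ) := by exact_mod_cast Fintype.card_pos
  have hrow : Integrable (fun ω => maxRowNorm (Matrix.of fun i j => X i j ω)) μ :=
    integrable_maxRowNorm hX
  have hcol : Integrable (fun ω => maxColNorm (Matrix.of fun i j => X i j ω)) μ :=
    integrable_maxRowNorm fun i j => hX j i
  have hflip (ε : Fin n × Fin n → ℤˣ) :
      Integrable (fun ω => ‖signFlip (Matrix.of fun i j => X i j ω) ε‖) μ :=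
    (integrable_matrix fun i j => (hX i j).const_mul _).norm
  -- Multiplying by the number of sign patterns turns the average over signs into a sum.
  refine le_of_mul_le_mul_right ?_ hN
  calc _ = ∑ ε : Fin n × Fin n → ℤˣ, ∫ ω, ‖Matrix.of fun i j => X i j ω‖ ∂μ := by
        rw [Finset.sum_const, Finset.card_univ, nsmul_eq_mul, mul_comm]
    _ ≤ ∑ ε : Fin n × Fin n → ℤˣ, 2 * ∫ ω, ‖signFlip (Matrix.of fun i j => X i j ω) ε‖ ∂μ :=
        Finset.sum_le_sum fun ε _ => integral_norm_le_two_mul_integral_norm_signFlip hind hX h0 ε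
    _ = 2 * ∫ ω, ∑ ε : Fin n × Fin n → ℤˣ, ‖signFlip (Matrix.of fun i j => X i j ω) ε‖ ∂μ := by
        rw [← Finset.mul_sum, integral_finsetSum _ fun ε _ => hflip ε]
    _ ≤ 2 * ∫ ω, 4 * √(Nat.clog 2 n : ℝ) * (maxRowNorm (Matrix.of fun i j => X i j ω) +
          maxColNorm (Matrix.of fun i j => X i j ω)) * Fintype.card (Fin n × Fin n → ℤˣ) ∂μ := by
        gcongr
        · exact integrable_finsetSum _ fun ε _ => hflip ε
        · exact ((hrow.add hcol).const_mul _).mul_const _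
        · exact fun ω => sum_norm_signFlip_le hn _
    _ = _ := by
        rw [integral_mul_const, integral_const_mul, integral_add hrow hcol]
        ring

end Symmetrization

/-! ### Comparison of logarithms and conclusion. -/

lemma sqrt_clog_two_le {n : ℕ} (hn : 2 ≤ n) :
    √(Nat.clog 2 n : ℝ) ≤ 4 * Real.log n ^ (3 / 2 : ℝ) := by
  have hlog2 : (1 / 2 : ℝ) < Real.log 2 := by linarith [Real.log_two_gt_d9]
  have hlog : Real.log 2 ≤ Real.log n := Real.log_le_log (by norm_num) (by exact_mod_cast hn)
  have hpos : 0 < Real.log n := by linarith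
  -- As `log 2 > 1/2`, the left side is at most `2 log n + 1`, and `1 ≤ 2 log n`.
  have hclog : (Nat.clog 2 n : ℝ) ≤ 4 * Real.log n := by
    have h1 : 2 ^ (Nat.clog 2 n - 1) < n := Nat.pow_pred_clog_lt_self (by norm_num) (by omega)
    have h2 : ((Nat.clog 2 n - 1 : ℕ) : ℝ) * Real.log 2 ≤ Real.log n := by
      rw [← Real.log_pow]
      exact Real.log_le_log (by positivity) (by exact_mod_cast h1.le)
    have h3 : (Nat.clog 2 n : ℝ) ≤ ((Nat.clog 2 n - 1 : ℕ) : ℝ) + 1 := by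
      exact_mod_cast (by omega : Nat.clog 2 n ≤ Nat.clog 2 n - 1 + 1)
    nlinarith
  have hrpow : Real.log n ^ (3 / 2 : ℝ) = Real.log n * √(Real.log n) := by
    rw [show (3 / 2 : ℝ) = 1 + 1 / 2 by norm_num, Real.rpow_add hpos, Real.rpow_one,
      Real.sqrt_eq_rpow]
  calc √(Nat.clog 2 n : ℝ) ≤ √(4 * Real.log n) := Real.sqrt_le_sqrt hclog
    _ = 2 * √(Real.log n) := by
        rw [Real.sqrt_mul (by norm_num), show (4 : ℝ) = 2 ^ 2 by norm_num,
          Real.sqrt_sq (by norm_num)]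
    _ ≤ 4 * (Real.log n * √(Real.log n)) := by nlinarith [Real.sqrt_nonneg (Real.log n)]
    _ = _ := by rw [hrpow]

theorem theorem1p2 :
    ∃ c : ℝ, 0 < c ∧
      ∀ (n : ℕ), 2 ≤ n →
      ∀ (Ω : Type*) [MeasurableSpace Ω] (μ : Measure Ω) [IsProbabilityMeasure μ]
        (X : Fin n → Fin n → Ω → ℝ),
        iIndepFun (fun (p : Fin n × Fin n) => X p.1 p.2) μ →
        (∀ i j, Integrable (X i j) μ) →
        (∀ i j, ∫ ω, X i j ω ∂μ = 0) →
        ∫ ω, opNorm22 (Matrix.of fun i j => X i j ω) ∂μ ≤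
          c * Real.log (n : ℝ) ^ (3 / 2 : ℝ) *
            (∫ ω, maxRowNorm (Matrix.of fun i j => X i j ω) ∂μ +
              ∫ ω, maxColNorm (Matrix.of fun i j => X i j ω) ∂μ) := by
  -- 32 is 8 from `integral_norm_le_sqrt_clog` times 4 from `sqrt_clog_two_le`.
  refine ⟨32, by norm_num, fun n hn Ω _ μ _ X hind hX h0 => ?_⟩
  refine (integral_norm_le_sqrt_clog hn hind hX h0).trans ?_
  have h1 : 0 ≤ ∫ ω, maxRowNorm (Matrix.of fun i j => X i j ω) ∂μ +
      ∫ ω, maxColNorm (Matrix.of fun i j => X i j ω) ∂μ :=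
    add_nonneg (integral_nonneg fun ω => maxRowNorm_nonneg _)
      (integral_nonneg fun ω => maxColNorm_nonneg _)
  refine mul_le_mul_of_nonneg_right ?_ h1
  linarith [sqrt_clog_two_le hn]
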